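/- Let $q>1$ be an odd integer and let $R$ be a commutative ring with unity, not of characteristic $2$, such that no homomorphic image of $R$ is isomorphic to $\mathbb{F}_3$ and such that $q-1$ is a unit in $R$. An element $u$ of a ring is called $q$-potent if $u^q=u$; $\mathbb{M}_n(R)$ denotes the ring of $n\times n$ matrices over $R$. Then the following assertions are equivalent. (1) For every positive integer $n$, every matrix in $\mathbb{M}_n(R)$ is a sum of an idempotent matrix and an invertible $q$-potent matrix. (2) There exists a positive integer $n$ such that every matrix in $\mathbb{M}_n(R)$ is a sum of an idempotent matrix and an invertible $q$-potent matrix. (3) For every positive integer $n$, every matrix in $\mathbb{M}_n(R)$ is a sum of an idempotent matrix and a $q$-potent matrix. (4) There exists a positive integer $n$ such that every matrix in $\mathbb{M}_n(R)$ is a sum of an idempotent matrix and a $q$-potent matrix. (5) The ring $R$ satisfies the identity $x^q=x$, that is, $x^q=x$ for all $x\in R$. -/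

import Mathlib

/-- Every element of the ring `A` is a sum of an idempotent and a `q`-potent
(an element `u` with `u ^ q = u`). -/
def IsSumIdempotentPotent (q : ℕ) (A : Type*) [Ring A] : Prop :=
  ∀ a : A, ∃ e u : A, IsIdempotentElem e ∧ u ^ q = u ∧ a = e + u

/-- Every element of the ring `A` is a sum of an idempotent and an invertible `q`-potent. -/
def IsSumIdempotentInvertiblePotent (q : ℕ) (A : Type*) [Ring A] : Prop :=
  ∀ a : A, ∃ e u : A, IsIdempotentElem e ∧ IsUnit u ∧ u ^ q = u ∧ a = e + u

/-! To derive `x ^ q = x`, split a scalar matrix as `a • 1 = e + u`. One diagonal entry shows that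
nilpotents vanish and that, modulo each prime, `a` or `a - 1` is `q`-potent. The quotient domain is
then a finite field. If the nonzero `q`-potents were a proper subgroup of its units, the `q`-potents
and their translate by `1` would be too few to cover it (`pow_eq_self_of_pow_eq_self_or_sub_one`).

Conversely, put `k = q - 1`. A suitable finitely generated subring containing the matrix entries is
a finite product of fields, and over a field it suffices to treat a cyclic endomorphism. In a
Krylov-type basis (`exists_basis_shiftedKrylov`) it has ones below a diagonal that may be prescribed
up to its sum, the trace. Write this diagonal as `ε + u` and share the ones alternately between an
idempotent and a `U` with `U ^ k = 1` (`isIdempotentAddRoot_of_chain`). Suitable `ε` and `u` exist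
once the field has three nonzero elements (`exists_diagonal_pattern`); this is where `𝔽₃` must be
excluded. -/

/-! ### From decompositions of scalar matrices to `x ^ q = x` -/

/-- Decomposing the scalar matrix `a` as idempotent plus `q`-potent yields a partition of unity
separating the two ways `a` can be built from a `q`-potent. -/
theorem IsSumIdempotentPotent.exists_annihilator {R : Type*} [CommRing R] {q n : ℕ} (hn : 0 < n)
    (h : IsSumIdempotentPotent q (Matrix (Fin n) (Fin n) R)) (a : R) :
    ∃ s : R, s * (a ^ q - a) = 0 ∧ (1 - s) * ((a - 1) ^ q - (a - 1)) = 0 := by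
  obtain ⟨e, u, he, hu, hau⟩ := h (a • 1)
  have hu' : u = a • 1 - e := by rw [hau]; abel
  have he' : e * e = e := he
  have h1 : (1 - e) * u = a • (1 - e) := by
    rw [hu', sub_mul, mul_sub, mul_sub, he']; simp [smul_sub]
  have h2 : e * u = (a - 1) • e := by
    rw [hu', mul_sub, he', sub_smul]; simp
  have h3 (k : ℕ) : (1 - e) * u ^ k = a ^ k • (1 - e) := by
    induction k with
    | zero => simp
    | succ k ih => rw [pow_succ, ← mul_assoc, ih, smul_mul_assoc, h1, smul_smul, pow_succ]
  have h4 (k : ℕ) : e * u ^ k = (a - 1) ^ k • e := by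
    induction k with
    | zero => simp
    | succ k ih => rw [pow_succ, ← mul_assoc, ih, smul_mul_assoc, h2, smul_smul, pow_succ]
  have h5 := h3 q
  have h6 := h4 q
  rw [hu, h1] at h5
  rw [hu, h2] at h6
  have h7 := congrFun (congrFun h5 ⟨0, hn⟩) ⟨0, hn⟩
  have h8 := congrFun (congrFun h6 ⟨0, hn⟩) ⟨0, hn⟩
  simp only [Matrix.smul_apply, Matrix.sub_apply, Matrix.one_apply_eq, smul_eq_mul] at h7 h8
  refine ⟨1 - e ⟨0, hn⟩ ⟨0, hn⟩, ?_, ?_⟩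
  · linear_combination -h7
  · linear_combination -h8

/-- A partition of unity as in `IsSumIdempotentPotent.exists_annihilator` excludes nilpotents. -/
theorem eq_zero_of_sq_eq_zero_of_exists_annihilator {R : Type*} [CommRing R] {q : ℕ} (hq : 1 < q)
    (hodd : Odd q) (hunit : IsUnit ((q : R) - 1)) {a : R} (ha : a ^ 2 = 0)
    (h : ∃ s : R, s * (a ^ q - a) = 0 ∧ (1 - s) * ((a - 1) ^ q - (a - 1)) = 0) : a = 0 := by
  obtain ⟨s, h1, h2⟩ := h
  have h3 : a ^ q = 0 := pow_eq_zero_of_le hq ha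
  have h4 (k : ℕ) : (1 - a) ^ k = 1 - k * a := by
    induction k with
    | zero => simp
    | succ k ih => rw [pow_succ, ih]; push_cast; linear_combination (k : R) * ha
  have h5 : (a - 1) ^ q = -(1 - q * a) := by
    rw [← h4, ← hodd.neg_pow, neg_sub]
  rw [h3] at h1
  rw [h5] at h2
  -- As `a ^ 2 = 0`, only the linear term of `(a - 1) ^ q` survives next to the constant; `h1`
  -- meanwhile says `s * a = 0`.
  have h6 : ((q : R) - 1) * ((1 - s) * a) = 0 := by linear_combination h2
  have h7 := (hunit.mul_right_eq_zero).1 h6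
  linear_combination h7 - h1

/-- A domain in which every element is `q`-potent or one more than a `q`-potent satisfies
`x ^ q = x`. -/
theorem pow_eq_self_of_pow_eq_self_or_sub_one {D : Type*} [CommRing D] [IsDomain D] {q : ℕ}
    (hq : 1 < q) (hodd : Odd q) (h : ∀ a : D, a ^ q = a ∨ (a - 1) ^ q = a - 1) (x : D) :
    x ^ q = x := by
  classical
  have hfinG : {a : D | a ^ q = a}.Finite := by
    have hne : (Polynomial.X ^ q - Polynomial.X : Polynomial D) ≠ 0 := by
      intro h0
      have h1 := congrArg (fun p => Polynomial.coeff p q) h0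
      simp [Polynomial.coeff_X, hq.ne] at h1
    refine (Polynomial.finite_setOfPred_isRoot hne).subset fun a ha => ?_
    have ha' : a ^ q = a := ha
    simp [Polynomial.IsRoot, ha']
  have hfin : Finite D := by
    rw [← Set.finite_univ_iff]
    refine (hfinG.union (hfinG.image (· + 1))).subset fun a _ => ?_
    rcases h a with ha | ha
    · exact Or.inl ha
    · exact Or.inr ⟨a - 1, ha, by simp⟩
  have := Fintype.ofFinite D
  let _ : Field D := Fintype.fieldOfDomain D
  obtain ⟨k, rfl⟩ : ∃ k, q = k + 1 := ⟨q - 1, by omega⟩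
  let H : Subgroup Dˣ := (powMonoidHom k : Dˣ →* Dˣ).ker
  have hH (u : Dˣ) : u ∈ H ↔ u ^ k = 1 := by simp [H, MonoidHom.mem_ker]
  by_cases htop : H = ⊤
  · rcases eq_or_ne x 0 with rfl | hx
    · simp
    · have := (hH (Units.mk0 x hx)).1 (htop ▸ Subgroup.mem_top _)
      have h1 : x ^ k = 1 := by simpa using congrArg Units.val this
      rw [pow_succ, h1, one_mul]
  exfalso
  have hcard : Nat.card H * 2 ≤ Nat.card Dˣ := by
    rw [← H.card_mul_index]
    refine Nat.mul_le_mul_left _ ?_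
    have h1 : H.index ≠ 1 := fun hh => htop (Subgroup.index_eq_one.1 hh)
    have h2 : H.index ≠ 0 := Subgroup.index_ne_zero_of_finite
    omega
  have hD : Nat.card D = Nat.card Dˣ + 1 := by
    rw [Nat.card_units, Nat.sub_add_cancel Nat.card_pos]
  let G : Finset D := Finset.univ.filter fun a => a ^ (k + 1) = a
  have hG : G.card ≤ Nat.card H + 1 := by
    have : G ⊆ insert 0 (Finset.univ.image fun u : ↥H => ((u : Dˣ) : D)) := by
      intro a ha
      have ha' : a ^ (k + 1) = a := by simpa [G] using ha
      rcases eq_or_ne a 0 with rfl | h0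
      · simp
      · refine Finset.mem_insert_of_mem 
          (Finset.mem_image.2 ⟨⟨Units.mk0 a h0, ?_⟩, Finset.mem_univ _, rfl⟩)
        rw [hH]
        ext
        have : a ^ k * a = 1 * a := by rw [← pow_succ, ha', one_mul]
        simpa using mul_right_cancel₀ h0 this
    refine (Finset.card_le_card this).trans ((Finset.card_insert_le _ _).trans ?_)
    refine Nat.add_le_add_right (Finset.card_image_le.trans ?_) 1
    rw [Nat.card_eq_fintype_card, Finset.card_univ]
  let G' : Finset D := G.image (· + 1)
  have hunion : G ∪ G' = Finset.univ := by
    ext a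
    simp only [Finset.mem_union, Finset.mem_univ, iff_true]
    rcases h a with ha | ha
    · exact Or.inl (by simpa [G] using ha)
    · exact Or.inr (Finset.mem_image.2 ⟨a - 1, by simpa [G] using ha, by simp⟩)
  -- Since `q` is odd, `-1` is `q`-potent, so `0` and `1` lie in both sets. Hence `|D| + 2 ≤ 2|G| ≤
  -- 2|H| + 2 ≤ |Dˣ| + 2 = |D| + 1`, a contradiction.
  have hinter : ({0, 1} : Finset D) ⊆ G ∩ G' := by
    intro a ha
    rw [Finset.mem_insert, Finset.mem_singleton] at ha
    rcases ha with rfl | rfl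
    · exact Finset.mem_inter.2 ⟨by simp [G],
        Finset.mem_image.2 ⟨-1, by simp [G, hodd.neg_pow], by simp⟩⟩
    · exact Finset.mem_inter.2 ⟨by simp [G], Finset.mem_image.2 ⟨0, by simp [G], by simp⟩⟩
  have h1 := Finset.card_union_add_card_inter G G'
  have h2 := Finset.card_le_card hinter
  have h3 : G'.card ≤ G.card := Finset.card_image_le
  rw [hunion, Finset.card_univ, ← Nat.card_eq_fintype_card] at h1
  rw [Finset.card_pair zero_ne_one] at h2
  omega

/-- Once `R` is reduced, an identity can be checked in the domains `R ⧸ P`, where the partition of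
unity becomes an alternative. -/
theorem IsSumIdempotentPotent.pow_eq_self {R : Type*} [CommRing R] {q n : ℕ} (hq : 1 < q)
    (hodd : Odd q) (hunit : IsUnit ((q : R) - 1)) (hn : 0 < n)
    (h : IsSumIdempotentPotent q (Matrix (Fin n) (Fin n) R)) (x : R) : x ^ q = x := by
  have hann := h.exists_annihilator hn
  have hred : IsReduced R := by
    rw [isReduced_iff_pow_one_lt 2 one_lt_two]
    exact fun a ha => eq_zero_of_sq_eq_zero_of_exists_annihilator hq hodd hunit ha (hann a)
  rw [← sub_eq_zero, ← Ideal.mem_bot, ← nilradical_eq_bot_iff.2 hred, nilradical_eq_sInf,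
    Ideal.mem_sInf]
  intro P hP
  have hP' : P.IsPrime := hP
  rw [← Ideal.Quotient.eq_zero_iff_mem, map_sub, map_pow, sub_eq_zero]
  refine pow_eq_self_of_pow_eq_self_or_sub_one hq hodd (fun a => ?_) _
  obtain ⟨a, rfl⟩ := Ideal.Quotient.mk_surjective a
  obtain ⟨s, h1, h2⟩ := hann a
  replace h1 := congrArg (Ideal.Quotient.mk P) h1
  replace h2 := congrArg (Ideal.Quotient.mk P) h2
  simp only [map_mul, map_sub, map_pow, map_one, map_zero] at h1 h2
  rcases mul_eq_zero.1 h1 with hs | hs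
  · right
    rw [hs, sub_zero, one_mul, sub_eq_zero] at h2
    exact h2
  · exact Or.inl (sub_eq_zero.1 hs)

/-! ### Cyclic endomorphisms in a Krylov-type basis -/

/-- The element `b` is the sum of an idempotent and a root of `u ^ k = 1`. -/
def IsIdempotentAddRoot {B : Type*} [Ring B] (k : ℕ) (b : B) : Prop :=
  ∃ e u : B, IsIdempotentElem e ∧ u ^ k = 1 ∧ b = e + u

theorem IsIdempotentAddRoot.map {B C : Type*} [Ring B] [Ring C] {k : ℕ} {b : B}
    (h : IsIdempotentAddRoot k b) (f : B →+* C) : IsIdempotentAddRoot k (f b) := by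
  obtain ⟨e, u, he, hu, rfl⟩ := h
  exact ⟨f e, f u, he.map f, by rw [← map_pow, hu, map_one], map_add f e u⟩

section Chain

variable {K V : Type*} [Field K] [AddCommGroup V] [Module K V]

/-- The Krylov-type chain `x, (f - d 0) x, (f - d 1) (f - d 0) x, …`. -/
def shiftedKrylov (f : Module.End K V) (d : ℕ → K) (x : V) : ℕ → V
  | 0 => x
  | i + 1 => f (shiftedKrylov f d x i) - d i • shiftedKrylov f d x i

theorem apply_shiftedKrylov (f : Module.End K V) (d : ℕ → K) (x : V) (i : ℕ) :
    f (shiftedKrylov f d x i) = d i • shiftedKrylov f d x i + shiftedKrylov f d x (i + 1) := by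
  simp [shiftedKrylov]

theorem pow_apply_mem_span_shiftedKrylov (f : Module.End K V) (d : ℕ → K) (x : V) (i : ℕ) :
    (f ^ i) x ∈ Submodule.span K (shiftedKrylov f d x '' Set.Iic i) := by
  induction i with
  | zero => exact Submodule.subset_span ⟨0, by simp, rfl⟩
  | succ i ih =>
    rw [pow_succ', Module.End.mul_apply]
    have h : Submodule.span K (shiftedKrylov f d x '' Set.Iic i) ≤
        (Submodule.span K (shiftedKrylov f d x '' Set.Iic (i + 1))).comap f := by
      rw [Submodule.span_le]
      rintro _ ⟨j, hj, rfl⟩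
      have hj' : j ≤ i := hj
      rw [SetLike.mem_coe, Submodule.mem_comap, apply_shiftedKrylov]
      refine add_mem (Submodule.smul_mem _ _ (Submodule.subset_span ⟨j, ?_, rfl⟩))
        (Submodule.subset_span ⟨j + 1, ?_, rfl⟩)
      · exact hj'.trans (Nat.le_succ i)
      · exact Nat.succ_le_succ hj'
    exact h ih

/-- If `x` is a cyclic vector of `f` and the shifts sum to the trace of `f`, then the chain is a
basis in which `f` acts with the shifts on the diagonal. -/
theorem exists_basis_shiftedKrylov {N : ℕ} (hN : Module.finrank K V = N + 1)
    (f : Module.End K V) (d : ℕ → K) (x : V)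
    (hx : ⊤ ≤ Submodule.span K (Set.range fun i : Fin (N + 1) => (f ^ (i : ℕ)) x))
    (hd : ∑ i ∈ Finset.range (N + 1), d i = LinearMap.trace K V f) :
    ∃ b : Module.Basis (Fin (N + 1)) K V, (∀ i, b i = shiftedKrylov f d x i) ∧
      shiftedKrylov f d x (N + 1) ∈ Submodule.span K (shiftedKrylov f d x '' Set.Iio N) := by
  have hspan : ⊤ ≤ Submodule.span K
      (Set.range fun i : Fin (N + 1) => shiftedKrylov f d x i) := by
    refine hx.trans (Submodule.span_le.2 ?_)
    rintro _ ⟨i, rfl⟩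
    refine Submodule.span_mono ?_ (pow_apply_mem_span_shiftedKrylov f d x i)
    rintro _ ⟨j, hj, rfl⟩
    exact ⟨⟨j, lt_of_le_of_lt hj i.2⟩, rfl⟩
  let b := basisOfTopLeSpanOfCardEqFinrank _ hspan (by rw [hN, Fintype.card_fin])
  have hb (i) : b i = shiftedKrylov f d x i := by simp [b]
  refine ⟨b, hb, ?_⟩
  -- The diagonal of `f` is `d 0, …, d N`, with this coordinate added to the last entry; the trace
  -- condition makes it vanish.
  have hlast : b.repr (shiftedKrylov f d x (N + 1)) (Fin.last N) = 0 := by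
    rw [LinearMap.trace_eq_matrix_trace K b, Matrix.trace, Fin.sum_univ_castSucc,
      Finset.sum_range_succ, ← Fin.sum_univ_eq_sum_range] at hd
    have h1 (i : Fin N) : Matrix.diag (LinearMap.toMatrix b b f) i.castSucc = d i := by
      have : shiftedKrylov f d x (i + 1) = b i.succ := by rw [hb]; rfl
      rw [Matrix.diag_apply, LinearMap.toMatrix_apply, hb, apply_shiftedKrylov, Fin.val_castSucc, this]
      have h' : shiftedKrylov f d x i = b i.castSucc := (hb i.castSucc).symm
      rw [h', map_add, map_smul, Module.Basis.repr_self, Module.Basis.repr_self]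
      have h'' : i.succ ≠ i.castSucc := (Fin.castSucc_lt_succ (i := i)).ne'
      simp [h'']
    have h2 : Matrix.diag (LinearMap.toMatrix b b f) (Fin.last N) =
        d N + b.repr (shiftedKrylov f d x (N + 1)) (Fin.last N) := by
      rw [Matrix.diag_apply, LinearMap.toMatrix_apply, hb, apply_shiftedKrylov, Fin.val_last]
      have h' : shiftedKrylov f d x N = b (Fin.last N) := (hb (Fin.last N)).symm
      rw [h', map_add, map_smul, Module.Basis.repr_self]
      simp
    rw [Finset.sum_congr rfl fun i _ => h1 i, h2, ← add_assoc] at hd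
    simpa using hd
  rw [← b.sum_repr (shiftedKrylov f d x (N + 1)), Fin.sum_univ_castSucc, hlast, zero_smul, add_zero]
  refine Submodule.sum_mem _ fun i _ => Submodule.smul_mem _ _ (Submodule.subset_span ?_)
  exact ⟨i, i.2, (hb i.castSucc).symm⟩

/-- Decomposition of an endomorphism that is lower bidiagonal in the basis `v 0, …, v N`, except
for its value at `v N`. The relation `σ` selects the subdiagonal entries given to the idempotent. -/
theorem isIdempotentAddRoot_of_chain {N k : ℕ} (hk : Even k) (f : Module.End K V) (v : ℕ → V)
    (b : Module.Basis (Fin (N + 1)) K V) (hb : ∀ i, b i = v i) (ε u : ℕ → K) (σ : ℕ → Prop)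
    (hf : ∀ i ≤ N, f (v i) = (ε i + u i) • v i + v (i + 1))
    (hlast : v (N + 1) ∈ Submodule.span K (v '' Set.Iio N))
    (hε : ∀ i ≤ N, ε i * ε i = ε i) (hu : ∀ i ≤ N, u i ^ k = 1)
    (hσN : ¬ σ N)
    (hσ : ∀ i < N, σ i → ¬ σ (i + 1) ∧ ε i + ε (i + 1) = 1)
    (hσ' : ∀ i < N, ¬ σ i → σ (i + 1) ∧ u i + u (i + 1) = 0)
    (hc : ∀ i < N, u i ≠ u N) : IsIdempotentAddRoot k f := by
  classical
  let E : Module.End K V := b.constr K fun i => ε i • v i + if σ i then v (i + 1) else 0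
  have hE (i : ℕ) (hi : i ≤ N) : E (v i) = ε i • v i + if σ i then v (i + 1) else 0 := by
    have := b.constr_basis K (fun i => ε i • v i + if σ i then v (i + 1) else 0)
      ⟨i, Nat.lt_succ_of_le hi⟩
    rwa [hb] at this
  have hU (i : ℕ) (hi : i ≤ N) : (f - E) (v i) = u i • v i + if σ i then 0 else v (i + 1) := by
    rw [LinearMap.sub_apply, hf i hi, hE i hi]
    split_ifs
    · module
    · module
  refine ⟨E, f - E, b.ext fun i => ?_, ?_, by abel⟩
  · have hi : (i : ℕ) ≤ N := Nat.lt_succ_iff.1 i.2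
    rw [hb, Module.End.mul_apply, hE _ hi, map_add, map_smul, hE _ hi]
    by_cases hs : σ i
    · have hiN : (i : ℕ) < N := lt_of_le_of_ne hi fun h => hσN (h ▸ hs)
      obtain ⟨h1, h2⟩ := hσ i hiN hs
      rw [if_pos hs, hE _ hiN, if_neg h1]
      linear_combination (norm := module) (hε i hi) • v i + h2 • v (i + 1)
    · rw [if_neg hs, map_zero]
      linear_combination (norm := module) (hε i hi) • v i
  generalize f - E = U at hU ⊢
  -- it suffices to find each basis vector in the fixed space `H` of `U ^ k`
  let H : Submodule K V := LinearMap.ker (U ^ k - 1)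
  have hH (x : V) : x ∈ H ↔ (U ^ k) x = x := by simp [H, sub_eq_zero]
  have hHU (x : V) (hx : x ∈ H) : U x ∈ H := by
    rw [hH] at hx ⊢
    rw [← Module.End.mul_apply, ← pow_succ, pow_succ', Module.End.mul_apply, hx]
  have heig (x : V) (c : K) (hx : U x = c • x) (hck : c ^ k = 1) : x ∈ H := by
    rw [hH]
    have (j : ℕ) : (U ^ j) x = c ^ j • x := by
      induction j with
      | zero => simp
      | succ j ih => rw [pow_succ', Module.End.mul_apply, ih, map_smul, hx, smul_smul, pow_succ]
    rw [this, hck, one_smul]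
  have hquad (x : V) (c : K) (hx : U (U x) = (c ^ 2) • x) (hck : c ^ k = 1) : x ∈ H := by
    rw [hH]
    have (j : ℕ) : (U ^ (2 * j)) x = c ^ (2 * j) • x := by
      induction j with
      | zero => simp
      | succ j ih =>
        rw [mul_add, mul_one, add_comm, pow_add, Module.End.mul_apply, ih, map_smul, pow_two U,
          Module.End.mul_apply, hx, smul_smul]
        ring_nf
    obtain ⟨j, rfl⟩ := hk
    rw [← two_mul] at hck ⊢
    rw [this, hck, one_smul]
  -- Each such `v i` is an eigenvector of `U` or, with `v (i + 1)`, spans a block on which `U ^ 2`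
  -- is the scalar `u i ^ 2`. As `u N` is not an eigenvalue there, `U - u N • 1` is invertible on
  -- the block.
  have hmem (i : ℕ) (hi : i < N) : v i ∈ H ⊓ H.map (U - u N • 1) := by
    by_cases hs : σ i
    · have h1 := hU i hi.le
      rw [if_pos hs, add_zero] at h1
      have h2 : v i ∈ H := heig _ _ h1 (hu i hi.le)
      refine ⟨h2, (u i - u N)⁻¹ • v i, H.smul_mem _ h2, ?_⟩
      have h3 : u i - u N ≠ 0 := sub_ne_zero.2 (hc i hi)
      rw [map_smul, LinearMap.sub_apply, h1, LinearMap.smul_apply, Module.End.one_apply, ← sub_smul,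
        smul_smul, inv_mul_cancel₀ h3, one_smul]
    · obtain ⟨hs', huu⟩ := hσ' i hi hs
      have hi' : i + 1 < N := lt_of_le_of_ne hi fun h => hσN (h ▸ hs')
      have h1 := hU i hi.le
      have h1' := hU (i + 1) hi
      rw [if_neg hs] at h1
      rw [if_pos hs', add_zero] at h1'
      have h4 : U (U (v i)) = (u i ^ 2) • v i := by
        rw [h1, map_add, map_smul, h1, h1']
        linear_combination (norm := module) huu • v (i + 1)
      have h2 : v i ∈ H := hquad _ _ h4 (hu i hi.le)
      have h3 : u i ^ 2 - u N ^ 2 ≠ 0 := by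
        have := mul_ne_zero (sub_ne_zero.2 (hc i hi)) (sub_ne_zero.2 (hc (i + 1) hi'))
        rw [eq_neg_of_add_eq_zero_right huu] at this
        intro h0
        apply this
        linear_combination -h0
      refine ⟨h2, (u i ^ 2 - u N ^ 2)⁻¹ • (U (v i) + u N • v i),
        H.smul_mem _ (H.add_mem (hHU _ h2) (H.smul_mem _ h2)), ?_⟩
      have h5 : (U - u N • 1) (U (v i) + u N • v i) = (u i ^ 2 - u N ^ 2) • v i := by
        rw [map_add, map_smul, LinearMap.sub_apply, LinearMap.sub_apply, h4, LinearMap.smul_apply,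
          LinearMap.smul_apply, Module.End.one_apply, Module.End.one_apply]
        module
      rw [map_smul, h5, smul_smul, inv_mul_cancel₀ h3, one_smul]
  have hlast' : v (N + 1) ∈ H.map (U - u N • 1) := by
    refine (Submodule.span_le.2 ?_ : Submodule.span K (v '' Set.Iio N) ≤ _) hlast
    rintro _ ⟨i, hi, rfl⟩
    exact (hmem i hi).2
  have hvN : v N ∈ H := by
    obtain ⟨y, hy, hyv⟩ := hlast'
    have h1 := hU N le_rfl
    rw [if_neg hσN, ← hyv] at h1
    -- Subtracting the preimage `y` of `v (N + 1)` under `U - u N • 1` corrects `v N` to an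
    -- eigenvector.
    have h2 : v N - y ∈ H := by
      refine heig _ (u N) ?_ (hu N le_rfl)
      rw [map_sub, h1, LinearMap.sub_apply, LinearMap.smul_apply, Module.End.one_apply]
      module
    have := H.add_mem h2 hy
    rwa [sub_add_cancel] at this
  refine b.ext fun i => ?_
  rw [hb, Module.End.one_apply, ← hH]
  rcases (Nat.lt_succ_iff.1 i.2).lt_or_eq with h | h
  · exact (hmem _ h).1
  · rw [h]; exact hvN

end Chain

/-- A direct sum of endomorphisms that are idempotent plus root of unity is again of this form. -/
theorem isIdempotentAddRoot_pi {K ι : Type*} [Field K] {N : ι → Type*} [∀ i, AddCommGroup (N i)]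
    [∀ i, Module K (N i)] {k : ℕ} (f : ∀ i, Module.End K (N i))
    (h : ∀ i, IsIdempotentAddRoot k (f i)) :
    IsIdempotentAddRoot k
      (LinearMap.pi fun i => f i ∘ₗ LinearMap.proj i : Module.End K (∀ i, N i)) := by
  choose e u he hu hf using h
  refine ⟨LinearMap.pi fun i => e i ∘ₗ LinearMap.proj i,
    LinearMap.pi fun i => u i ∘ₗ LinearMap.proj i, ?_, ?_, ?_⟩
  · refine LinearMap.ext fun x => funext fun i => ?_
    exact LinearMap.congr_fun (he i) (x i)
  · have hpow (j : ℕ) (x : ∀ i, N i) (i : ι) :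
        ((LinearMap.pi fun i => u i ∘ₗ LinearMap.proj i : Module.End K (∀ i, N i)) ^ j) x i =
          (u i ^ j) (x i) := by
      induction j with
      | zero => rfl
      | succ j ih => rw [pow_succ', pow_succ', Module.End.mul_apply, Module.End.mul_apply, ← ih]; rfl
    refine LinearMap.ext fun x => funext fun i => ?_
    rw [hpow, hu]
    rfl
  · refine LinearMap.ext fun x => funext fun i => ?_
    exact LinearMap.congr_fun (hf i) (x i)

/-! ### Choice of the two diagonals -/

theorem sum_range_two_mul_ite_even {K : Type*} [CommRing K] (x y : K) (m : ℕ) :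
    ∑ i ∈ Finset.range (2 * m), (if Even i then x else y) = m * (x + y) := by
  induction m with
  | zero => simp
  | succ m ih =>
    rw [mul_add, mul_one, Finset.sum_range_succ, Finset.sum_range_succ, ih, if_pos (even_two_mul m),
      if_neg (by simp [parity_simps])]
    push_cast
    ring

/-- The elements `1`, `-1`, `w` are nonzero and distinct, so two values cannot exhaust them. -/
theorem exists_ne_zero_ne_ne {K : Type*} [Field K] (h2 : (2 : K) ≠ 0) {w : K} (hw : w ^ 3 ≠ w)
    (x y : K) : ∃ a : K, a ≠ 0 ∧ a ≠ x ∧ a ≠ y := by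
  have hw0 : w ≠ 0 := by rintro rfl; simp at hw
  have hw1 : w ≠ 1 := by rintro rfl; simp at hw
  have hw2 : w ≠ -1 := by rintro rfl; exact hw (by ring)
  have h11 : (1 : K) ≠ -1 := fun h => h2 (by linear_combination h)
  have h10 : (-1 : K) ≠ 0 := neg_ne_zero.2 one_ne_zero
  by_contra! h
  have a1 : 1 = x ∨ 1 = y := or_iff_not_imp_left.2 (h 1 one_ne_zero)
  have a2 : -1 = x ∨ -1 = y := or_iff_not_imp_left.2 (h (-1) h10)
  have a3 : w = x ∨ w = y := or_iff_not_imp_left.2 (h w hw0)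
  rcases a1 with rfl | rfl <;> rcases a2 with a2 | a2 <;> rcases a3 with a3 | a3 <;> grind

/-- The diagonal entries of the idempotent and of the root of unity, for a prescribed trace. -/
theorem exists_diagonal_pattern {K : Type*} [Field K] (h2 : (2 : K) ≠ 0) {w : K} (hw : w ^ 3 ≠ w)
    (N : ℕ) (t : K) : ∃ (ε u : ℕ → K) (σ : ℕ → Prop),
      ∑ i ∈ Finset.range (N + 1), (ε i + u i) = t ∧
      (∀ i ≤ N, ε i * ε i = ε i) ∧ (∀ i ≤ N, u i ≠ 0) ∧ ¬ σ N ∧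
      (∀ i < N, σ i → ¬ σ (i + 1) ∧ ε i + ε (i + 1) = 1) ∧
      (∀ i < N, ¬ σ i → σ (i + 1) ∧ u i + u (i + 1) = 0) ∧ ∀ i < N, u i ≠ u N := by
  rcases Nat.even_or_odd' N with ⟨m, rfl | rfl⟩
  -- Here `u` cancels in the pairs `(0, 1), (2, 3), …` and `ε` sums to `1` on `(1, 2), (3, 4), …`.
  -- This leaves `ε 0 = δ` and `u N = c` to fit the trace; `δ = 1` is needed only when `δ = 0` would
  -- give `c = 0`.
  · obtain ⟨δ, c, hδ, hc, ht⟩ : ∃ δ c : K, δ * δ = δ ∧ c ≠ 0 ∧ m + δ + c = t := by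
      by_cases h : t - m = 0
      · exact ⟨1, t - m - 1, by ring, by rw [h]; simp, by ring⟩
      · exact ⟨0, t - m, by ring, h, by ring⟩
    obtain ⟨a, ha, hac, hac'⟩ := exists_ne_zero_ne_ne h2 hw c (-c)
    have hac'' : -a ≠ c := fun h => hac' (by rw [← h, neg_neg])
    refine ⟨fun i => (if Even i then 1 else 0) + (if i = 0 then δ - 1 else 0),
      fun i => (if Even i then a else -a) + (if i = 2 * m then c - a else 0), fun i => ¬ Even i,
      ?_, ?_, ?_, ?_, ?_, ?_, ?_⟩
    · simp only [Finset.sum_add_distrib, Finset.sum_ite_eq', Finset.sum_range_succ _ (2 * m),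
        sum_range_two_mul_ite_even]
      rcases Nat.eq_zero_or_pos m with rfl | hm
      · simp at ht ⊢
        linear_combination ht
      · have : 2 * m ≠ 0 := by omega
        simp [this, hm]
        linear_combination ht
    · intro i _
      by_cases h0 : i = 0
      · simp [h0, hδ]
      · by_cases he : Even i <;> simp [h0, he]
    · intro i _
      by_cases h0 : i = 2 * m
      · simp [h0, hc]
      · by_cases he : Even i <;> simp [h0, he, ha]
    · simp
    · intro i _ hi
      have h0 : i ≠ 0 := by rintro rfl; simp at hi
      simp [hi, h0, Nat.even_add_one]
    · intro i hi hi'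
      rw [not_not] at hi'
      have h0 : i + 1 ≠ 2 * m := by
        intro h
        have : Even (i + 1) := h ▸ even_two_mul m
        exact (Nat.even_add_one.1 this) hi'
      simp [hi', h0, hi.ne, Nat.even_add_one]
    · intro i hi
      by_cases he : Even i <;> simp [hi.ne, he, hac, hac'']
  -- Now the pairings are exchanged, leaving `u 0 = b` and `u N = c` to fit the trace. The two
  -- values forbidden to `b` ensure `c ≠ 0` and `b ≠ c`.
  · obtain ⟨b, hb, hb1, hb2⟩ := exists_ne_zero_ne_ne h2 hw (t - m - 1) ((t - m - 1) / 2)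
    obtain ⟨c, hc, hbc, ht⟩ : ∃ c : K, c ≠ 0 ∧ b ≠ c ∧ m + 1 + b + c = t := by
      refine ⟨t - m - 1 - b, sub_ne_zero.2 hb1.symm, fun h => hb2 ?_, by ring⟩
      rw [eq_div_iff h2]
      linear_combination h
    obtain ⟨a, ha, hac, hac'⟩ := exists_ne_zero_ne_ne h2 hw c (-c)
    have hac'' : -a ≠ c := fun h => hac' (by rw [← h, neg_neg])
    have hodd : ¬ Even (2 * m + 1) := by simp [parity_simps]
    refine ⟨fun i => if Even i then 0 else 1,
      fun i => (if Even i then -a else a) + (if i = 0 then a + b else 0) +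
        (if i = 2 * m + 1 then c - a else 0), Even, ?_, ?_, ?_, hodd, ?_, ?_, ?_⟩
    · rw [show 2 * m + 1 + 1 = 2 * (m + 1) by ring]
      simp only [Finset.sum_add_distrib, Finset.sum_ite_eq', sum_range_two_mul_ite_even]
      rw [if_pos (by simp), if_pos (by simp; omega)]
      push_cast
      linear_combination ht
    · intro i _
      by_cases he : Even i <;> simp [he]
    · intro i _
      by_cases h0 : i = 2 * m + 1
      · subst h0; simp [hc, hodd]
      · rcases Nat.eq_zero_or_pos i with rfl | hi
        · simp [hb]
        · by_cases he : Even i <;> simp [h0, hi.ne', he, ha]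
    · intro i _ hi
      simp [hi, Nat.even_add_one]
    · intro i hi hi'
      have h0 : i ≠ 0 := by rintro rfl; simp at hi'
      have h1 : i ≠ 2 * m := by rintro rfl; simp at hi'
      simp [hi', h0, h1, hi.ne, Nat.even_add_one]
    · intro i hi
      rcases Nat.eq_zero_or_pos i with rfl | hi'
      · simp [hbc, hodd]
      · by_cases he : Even i <;> simp [hi.ne, hi'.ne', hodd, he, hac, hac'']

/-! ### Matrices over a field -/

theorem isIdempotentAddRoot_of_cyclic {K V : Type*} [Field K] [AddCommGroup V] [Module K V]
    (h2 : (2 : K) ≠ 0) {w : K} (hw : w ^ 3 ≠ w) {k : ℕ} (hk : Even k)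
    (hK : ∀ a : K, a ≠ 0 → a ^ k = 1) {n : ℕ} (hn : Module.finrank K V = n) (f : Module.End K V)
    (x : V) (hx : ⊤ ≤ Submodule.span K (Set.range fun i : Fin n => (f ^ (i : ℕ)) x)) :
    IsIdempotentAddRoot k f := by
  cases n with
  | zero =>
    have : Subsingleton V := by
      rw [← Submodule.subsingleton_iff K, ← subsingleton_iff_bot_eq_top, eq_comm, eq_bot_iff]
      exact hx.trans (Submodule.span_le.2 (by rintro _ ⟨i, _⟩; exact i.elim0))
    exact ⟨0, f, by simp [IsIdempotentElem], Subsingleton.elim _ _, by simp⟩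
  | succ N =>
    obtain ⟨ε, u, σ, hsum, hε, hu, hσN, hσ, hσ', hc⟩ :=
      exists_diagonal_pattern h2 hw N (LinearMap.trace K V f)
    obtain ⟨b, hb, hlast⟩ := exists_basis_shiftedKrylov hn f _ x hx hsum
    exact isIdempotentAddRoot_of_chain hk f _ b hb ε u σ (fun i _ => apply_shiftedKrylov f _ x i)
      hlast hε (fun i hi => hK _ (hu i hi)) hσN hσ hσ' hc

open Polynomial in
/-- The quotient of `K[X]` by `g` has the basis `1, X, …, X ^ (deg g - 1)`. -/
theorem exists_basis_quotient_span {K : Type*} [Field K] {g : K[X]} (hg : g ≠ 0) :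
    ∃ (n : ℕ) (b : Module.Basis (Fin n) K (K[X] ⧸ K[X] ∙ g)),
      ∀ i, b i = Submodule.Quotient.mk (X ^ (i : ℕ)) := by
  let e : AdjoinRoot g ≃ₗ[K] (K[X] ⧸ K[X] ∙ g) :=
    { toFun := fun x => x
      invFun := fun x => x
      left_inv := fun _ => rfl
      right_inv := fun _ => rfl
      map_add' := fun _ _ => rfl
      map_smul' := by
        intro a x
        obtain ⟨p, rfl⟩ := AdjoinRoot.mk_surjective x
        exact (AdjoinRoot.smul_mk g a p).symm }
  refine ⟨_, (AdjoinRoot.powerBasis hg).basis.map e, fun i => ?_⟩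
  rw [Module.Basis.map_apply, PowerBasis.coe_basis, AdjoinRoot.powerBasis_gen]
  exact (map_pow (AdjoinRoot.mk g) X i).symm

open Polynomial in
-- Through `f`, `V` is a `K[X]`-module and a direct sum of quotients `K[X] ⧸ (p ^ e)`; on each,
-- multiplication by `X` has the cyclic vector `1`.
theorem isIdempotentAddRoot_end {K V : Type*} [Field K] [AddCommGroup V] [Module K V]
    [FiniteDimensional K V] (h2 : (2 : K) ≠ 0) {w : K} (hw : w ^ 3 ≠ w) {k : ℕ} (hk : Even k)
    (hK : ∀ a : K, a ≠ 0 → a ^ k = 1) (f : Module.End K V) : IsIdempotentAddRoot k f := by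
  obtain ⟨ι, _, p, hp, e, ⟨φ⟩⟩ := Module.equiv_directSum_of_isTorsion
    (Module.AEval.isTorsion_of_finiteDimensional K V f)
  classical
  let ψ₀ : Module.AEval' f ≃ₗ[K[X]] ∀ i, K[X] ⧸ K[X] ∙ p i ^ e i :=
    φ.trans (DirectSum.linearEquivFunOnFintype K[X] ι _)
  let ψ : V ≃ₗ[K] ∀ i, K[X] ⧸ K[X] ∙ p i ^ e i :=
    (Module.AEval'.of f).trans (ψ₀.restrictScalars K)
  let F (i : ι) : Module.End K (K[X] ⧸ K[X] ∙ p i ^ e i) :=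
    (LinearMap.lsmul K[X] (K[X] ⧸ K[X] ∙ p i ^ e i) X).restrictScalars K
  have hcyc (i : ι) : IsIdempotentAddRoot k (F i) := by
    obtain ⟨n, b, hb⟩ := exists_basis_quotient_span (pow_ne_zero (e i) (hp i).ne_zero)
    have hF (j : ℕ) : (F i ^ j) (Submodule.Quotient.mk 1) = Submodule.Quotient.mk (X ^ j) := by
      induction j with
      | zero => rfl
      | succ j ih => rw [pow_succ', Module.End.mul_apply, ih, pow_succ']; rfl
    refine isIdempotentAddRoot_of_cyclic h2 hw hk hK
      (by rw [Module.finrank_eq_card_basis b, Fintype.card_fin]) _ (Submodule.Quotient.mk 1) ?_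
    rw [← b.span_eq]
    refine Submodule.span_mono ?_
    rintro _ ⟨j, rfl⟩
    exact ⟨j, by rw [hb]; exact hF j⟩
  have hconj : f = ψ.symm.conjRingEquiv
      (LinearMap.pi fun i => F i ∘ₗ LinearMap.proj i : Module.End K _) := by
    refine LinearMap.ext fun x => ψ.injective ?_
    rw [LinearEquiv.conjRingEquiv_apply_apply, LinearEquiv.symm_symm, LinearEquiv.apply_symm_apply]
    have h1 : ψ (f x) = ψ₀ ((X : K[X]) • Module.AEval'.of f x) := by
      rw [Module.AEval'.X_smul_of]; rfl
    rw [h1, map_smul]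
    rfl
  rw [hconj]
  exact (isIdempotentAddRoot_pi _ hcyc).map ψ.symm.conjRingEquiv.toRingHom

theorem isIdempotentAddRoot_matrix_field {K n : Type*} [Field K] [Fintype n] [DecidableEq n]
    (h2 : (2 : K) ≠ 0) {w : K} (hw : w ^ 3 ≠ w) {k : ℕ} (hk : Even k)
    (hK : ∀ a : K, a ≠ 0 → a ^ k = 1) (A : Matrix n n K) : IsIdempotentAddRoot k A := by
  have := (isIdempotentAddRoot_end h2 hw hk hK (Matrix.toLinAlgEquiv' A)).map
    (Matrix.toLinAlgEquiv' (R := K) (n := n)).symm.toRingEquiv.toRingHom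
  simpa using this

/-! ### From fields to commutative rings -/

theorem isIdempotentAddRoot_matrix_pi {ι n : Type*} [Fintype n] [DecidableEq n] {K : ι → Type*}
    [∀ i, CommRing (K i)] {k : ℕ} (A : Matrix n n (∀ i, K i))
    (h : ∀ i, IsIdempotentAddRoot k ((Pi.evalRingHom K i).mapMatrix A)) :
    IsIdempotentAddRoot k A := by
  choose e u he hu hA using h
  have hinj (B C : Matrix n n (∀ i, K i))
      (hBC : ∀ i, (Pi.evalRingHom K i).mapMatrix B = (Pi.evalRingHom K i).mapMatrix C) : B = C := by
    ext r c i
    exact congrFun (congrFun (hBC i) r) c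
  refine ⟨Matrix.of fun r c i => e i r c, Matrix.of fun r c i => u i r c, ?_, ?_, ?_⟩
  · refine hinj _ _ fun i => ?_
    rw [map_mul]
    exact he i
  · refine hinj _ _ fun i => ?_
    rw [map_pow, map_one]
    exact hu i
  · refine hinj _ _ fun i => ?_
    rw [map_add]
    exact hA i

/-- The case of a finitely generated ring, which is a finite product of fields. -/
theorem isIdempotentAddRoot_matrix_of_finiteType {S n : Type*} [CommRing S]
    [Algebra.FiniteType ℤ S] [Fintype n] [DecidableEq n] {k : ℕ} (hk : Even k) (hk0 : k ≠ 0)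
    (hS : ∀ x : S, x ^ (k + 1) = x) (h2 : IsUnit (2 : S))
    (h3 : Ideal.span (Set.range fun x : S => x ^ 3 - x) = ⊤) (A : Matrix n n S) :
    IsIdempotentAddRoot k A := by
  have hpow {D : Type _} [CommRing D] [IsDomain D] (hD : ∀ x : D, x ^ (k + 1) = x) (a : D)
      (ha : a ≠ 0) : a ^ k = 1 :=
    mul_right_cancel₀ ha (by rw [← pow_succ, hD, one_mul])
  have hquot (I : Ideal S) (x : S ⧸ I) : x ^ (k + 1) = x := by
    obtain ⟨x, rfl⟩ := Ideal.Quotient.mk_surjective x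
    rw [← map_pow, hS]
  have : IsNoetherianRing S := Algebra.FiniteType.isNoetherianRing ℤ S
  -- In a prime quotient `a ^ (k - 1)` inverts any `a ≠ 0`, so primes are maximal.
  have : Ring.KrullDimLE 0 S := by
    refine Ring.KrullDimLE.mk₀ fun I hI => Ideal.Quotient.maximal_of_isField _ ?_
    refine ⟨exists_pair_ne _, mul_comm, fun {a} ha => ⟨a ^ (k - 1), ?_⟩⟩
    rw [← pow_succ', Nat.sub_add_cancel (Nat.pos_of_ne_zero hk0)]
    exact hpow (hquot I) a ha
  have : IsArtinianRing S :=
    isArtinianRing_iff_isNoetherianRing_krullDimLE_zero.2 ⟨inferInstance, inferInstance⟩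
  have : IsReduced S := by
    rw [isReduced_iff_pow_one_lt (k + 1) (by omega)]
    exact fun x hx => by rw [← hS x, hx]
  let φ := (IsArtinianRing.equivPi S).toRingEquiv
  have hpi : IsIdempotentAddRoot k (φ.mapMatrix A) := by
    refine isIdempotentAddRoot_matrix_pi _ fun I => ?_
    let _ : Field (S ⧸ I.asIdeal) := Ideal.Quotient.field I.asIdeal
    obtain ⟨w, hw⟩ : ∃ w : S, w ^ 3 - w ∉ I.asIdeal := by
      by_contra! h
      refine I.isMaximal.ne_top (top_le_iff.1 ?_)
      rw [← h3, Ideal.span_le]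
      rintro _ ⟨x, rfl⟩
      exact h x
    refine isIdempotentAddRoot_matrix_field (w := Ideal.Quotient.mk _ w) ?_ ?_ hk
      (hpow (hquot _)) _
    · have := (h2.map (Ideal.Quotient.mk I.asIdeal)).ne_zero
      rwa [map_ofNat] at this
    · rwa [← Ideal.Quotient.eq_zero_iff_mem, map_sub, map_pow, sub_eq_zero] at hw
  have h := hpi.map φ.mapMatrix.symm.toRingHom
  rwa [show φ.mapMatrix.symm.toRingHom (φ.mapMatrix A) = A from
    φ.mapMatrix.symm_apply_apply A] at h

/-- A maximal ideal containing every `x ^ 3 - x` would have residue field `{0, 1, -1}`. In this form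
the exclusion of `𝔽₃` is witnessed by finitely many elements, so it passes to a finitely generated
subring containing them. -/
theorem span_pow_three_sub_self_eq_top {R : Type*} [CommRing R] (h2 : IsUnit (2 : R))
    (hF3 : ¬ ∃ f : R →+* ZMod 3, Function.Surjective f) :
    Ideal.span (Set.range fun x : R => x ^ 3 - x) = ⊤ := by
  classical
  by_contra h
  obtain ⟨I, hI, hle⟩ := Ideal.exists_le_maximal _ h
  let _ : Field (R ⧸ I) := Ideal.Quotient.field I
  have hcube (x : R ⧸ I) : x ^ 3 = x := by
    obtain ⟨x, rfl⟩ := Ideal.Quotient.mk_surjective x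
    rw [← sub_eq_zero, ← map_pow, ← map_sub, Ideal.Quotient.eq_zero_iff_mem]
    exact hle (Ideal.subset_span ⟨x, rfl⟩)
  have h2' : (2 : R ⧸ I) ≠ 0 := by
    have := (h2.map (Ideal.Quotient.mk I)).ne_zero
    rwa [map_ofNat] at this
  have h11 : (1 : R ⧸ I) ≠ -1 := fun h => h2' (by linear_combination h)
  have hall (x : R ⧸ I) : x = 0 ∨ x = 1 ∨ x = -1 := by
    have : x * ((x - 1) * (x + 1)) = 0 := by linear_combination hcube x
    rcases mul_eq_zero.1 this with h | h
    · exact Or.inl h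
    · rcases mul_eq_zero.1 h with h | h
      · exact Or.inr (Or.inl (sub_eq_zero.1 h))
      · exact Or.inr (Or.inr (eq_neg_of_add_eq_zero_left h))
  let _ : Fintype (R ⧸ I) := ⟨{0, 1, -1}, fun x => by simpa using hall x⟩
  have hcard : Fintype.card (R ⧸ I) = 3 := by
    change Finset.card {0, 1, -1} = 3
    rw [Finset.card_eq_three]
    exact ⟨0, 1, -1, zero_ne_one, (neg_ne_zero.2 one_ne_zero).symm, h11, rfl⟩
  let φ := ZMod.ringEquivOfPrime (R ⧸ I) Nat.prime_three hcard
  exact hF3 ⟨φ.symm.toRingHom.comp (Ideal.Quotient.mk I),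
    φ.symm.surjective.comp Ideal.Quotient.mk_surjective⟩

/-- The subring is generated by the entries of `A` and by the elements occurring in a relation `1 =
∑ c x * (x ^ 3 - x)`. -/
theorem isIdempotentAddRoot_matrix {R n : Type*} [CommRing R] [Fintype n] [DecidableEq n] {k : ℕ}
    (hk : Even k) (hk0 : k ≠ 0) (hR : ∀ x : R, x ^ (k + 1) = x) (h2 : IsUnit (2 : R))
    (h3 : Ideal.span (Set.range fun x : R => x ^ 3 - x) = ⊤) (A : Matrix n n R) :
    IsIdempotentAddRoot k A := by
  classical
  obtain ⟨c, hc⟩ := Finsupp.mem_ideal_span_range_iff_exists_finsupp.1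
    ((Ideal.eq_top_iff_one _).1 h3)
  let T : Finset R := c.support ∪ c.support.image c ∪
    Finset.univ.image fun ij : n × n => A ij.1 ij.2
  let S : Subalgebra ℤ R := Algebra.adjoin ℤ (T : Set R)
  have hTS {x : R} (hx : x ∈ T) : x ∈ S := Algebra.subset_adjoin hx
  have : Algebra.FiniteType ℤ S := S.fg_iff_finiteType.1 ⟨T, rfl⟩
  have hAS (i j : n) : A i j ∈ S :=
    hTS (Finset.mem_union_right _ (Finset.mem_image.2 ⟨(i, j), Finset.mem_univ _, rfl⟩))
  let A' : Matrix n n S := Matrix.of fun i j => ⟨A i j, hAS i j⟩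
  have hA : S.val.toRingHom.mapMatrix A' = A := by ext; rfl
  rw [← hA]
  refine (isIdempotentAddRoot_matrix_of_finiteType hk hk0 (fun x => Subtype.ext (hR x)) ?_ ?_
    A').map _
  -- Cancelling `2` in `2 ^ (k + 1) = 2` shows that its inverse is a power of `2`, hence lies in
  -- `S`.
  · refine IsUnit.of_mul_eq_one ((2 : S) ^ (k - 1)) (Subtype.ext ?_)
    have h : (2 : R) * 2 ^ k = 2 * 1 := by rw [← pow_succ', hR, mul_one]
    have h' := h2.mul_left_cancel h
    rw [← Nat.sub_add_cancel (Nat.pos_of_ne_zero hk0), pow_succ'] at h'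
    exact h'
  · rw [Ideal.eq_top_iff_one]
    have hsupp {x : R} (hx : x ∈ c.support) : x ∈ S :=
      hTS (Finset.mem_union_left _ (Finset.mem_union_left _ hx))
    have hval {x : R} (hx : x ∈ c.support) : c x ∈ S :=
      hTS (Finset.mem_union_left _ (Finset.mem_union_right _ (Finset.mem_image_of_mem _ hx)))
    have h1 : (1 : S) = ∑ x : c.support, (⟨c x, hval x.2⟩ : S) *
        ((⟨x, hsupp x.2⟩ : S) ^ 3 - ⟨x, hsupp x.2⟩) := by
      refine Subtype.ext ?_
      rw [Finsupp.sum, ← Finset.sum_coe_sort] at hc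
      simpa using hc.symm
    rw [h1]
    exact Ideal.sum_mem _ fun x _ => Ideal.mul_mem_left _ _ (Ideal.subset_span ⟨_, rfl⟩)

theorem isSumIdempotentInvertiblePotent_matrix {R n : Type*} [CommRing R] [Fintype n]
    [DecidableEq n] {q : ℕ} (hq : 1 < q) (hodd : Odd q) (h2 : IsUnit (2 : R))
    (hF3 : ¬ ∃ f : R →+* ZMod 3, Function.Surjective f) (hR : ∀ x : R, x ^ q = x) :
    IsSumIdempotentInvertiblePotent q (Matrix n n R) := by
  intro A
  obtain ⟨k, rfl⟩ : ∃ k, q = k + 1 := ⟨q - 1, by omega⟩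
  have hk : Even k := by simpa [parity_simps] using hodd
  have hk0 : k ≠ 0 := by omega
  obtain ⟨e, u, he, hu, hA⟩ := isIdempotentAddRoot_matrix hk hk0 hR h2
    (span_pow_three_sub_self_eq_top h2 hF3) A
  exact ⟨e, u, he, IsUnit.of_pow_eq_one hu hk0, by rw [pow_succ, hu, one_mul], hA⟩

theorem theorem1p4 (q : ℕ) (hq : 1 < q) (hodd : Odd q)
    (R : Type*) [CommRing R] (hchar : ¬ CharP R 2)
    (hF3 : ¬ ∃ f : R →+* ZMod 3, Function.Surjective f)
    (hunit : IsUnit ((q : R) - 1)) :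
    List.TFAE [
      ∀ n : ℕ, 0 < n → IsSumIdempotentInvertiblePotent q (Matrix (Fin n) (Fin n) R),
      ∃ n : ℕ, 0 < n ∧ IsSumIdempotentInvertiblePotent q (Matrix (Fin n) (Fin n) R),
      ∀ n : ℕ, 0 < n → IsSumIdempotentPotent q (Matrix (Fin n) (Fin n) R),
      ∃ n : ℕ, 0 < n ∧ IsSumIdempotentPotent q (Matrix (Fin n) (Fin n) R),
      ∀ x : R, x ^ q = x] := by
  have hweak (n : ℕ) (h : IsSumIdempotentInvertiblePotent q (Matrix (Fin n) (Fin n) R)) :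
      IsSumIdempotentPotent q (Matrix (Fin n) (Fin n) R) := fun A => by
    obtain ⟨e, u, he, -, hu, hA⟩ := h A
    exact ⟨e, u, he, hu, hA⟩
  -- As `q` is odd, `2` divides the unit `q - 1`.
  have h2 : IsUnit (2 : R) := by
    obtain ⟨m, rfl⟩ := hodd
    refine isUnit_of_dvd_unit ⟨m, ?_⟩ hunit
    push_cast
    ring
  tfae_have 1 → 2 := fun h => ⟨1, one_pos, h 1 one_pos⟩
  tfae_have 1 → 3 := fun h n hn => hweak n (h n hn)
  tfae_have 2 → 4 := fun ⟨n, hn, h⟩ => ⟨n, hn, hweak n h⟩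
  tfae_have 3 → 4 := fun h => ⟨1, one_pos, h 1 one_pos⟩
  tfae_have 4 → 5 := fun ⟨_, hn, h⟩ => h.pow_eq_self hq hodd hunit hn
  tfae_have 5 → 1 := fun h _ _ => isSumIdempotentInvertiblePotent_matrix hq hodd h2 hF3 h
  tfae_finish
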